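/- For nonzero integers $\alpha,t$ let $K(\alpha,t)$ denote the generalised continued fraction $$a_0+\cfrac{\beta_1}{a_1+\cfrac{\beta_2}{a_2+\cfrac{\beta_3}{a_3+\cdots}}}$$ with $a_0=t$ and, for $i\ge 1$ and $k=\lfloor i/4\rfloor$, $$\begin{array}{lll} i\equiv 1 \pmod 4: & \beta_i=3(12k+1)(3k+1)\alpha, & a_i=(2i+1)t^2,\\ i\equiv 2 \pmod 4: & \beta_i=3(12k+5)(3k+2)\alpha, & a_i=(2i+1)t,\\ i\equiv 3 \pmod 4: & \beta_i=3(12k+7)(6k+5)\alpha, & a_i=2(2i+1)t^2,\\ i\equiv 0 \pmod 4: & \beta_i=3(12k-1)(6k+1)\alpha, & a_i=(2i+1)t. \end{array}$$ A continued fraction converges to $y$ if the denominators of its convergents are nonzero from some index on and the convergents tend to $y$. Let $x\in\mathbb{R}$ be an algebraic number of degree $3$ over $\mathbb{Q}$. Then there are $a,b,c,d\in\mathbb{Z}$ with $ad-bc\neq 0$ and $c\ne 0$, and nonzero integers $\alpha,t$, such that $y=\frac{ax+b}{cx+d}$ satisfies $y^3-ty^2-\alpha=0$ and the continued fraction $K(\alpha,t)$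 converges to $y$. Consequently $x$ itself has an explicit closed-form generalised continued fraction: writing $x=\frac{uy+v}{wy+z}$ with $u=d$, $v=-b$, $w=-c$, $z=a$, the continued fraction $$\frac{u}{w}+\cfrac{vw-uz}{wz+w^2t+\cfrac{w^2\beta_1}{a_1+\cfrac{\beta_2}{a_2+\cfrac{\beta_3}{a_3+\cdots}}}}$$ converges to $x$. -/

import Mathlib

open Filter Topology

noncomputable section

/-- The infinite generalised continued fraction
`den 0 + num 1 / (den 1 + num 2 / (den 2 + num 3 / (den 3 + ⋯)))`.
The value `num 0` is not used. -/
def contFrac (num den : ℕ → ℝ) : GenContFract ℝ where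
  h := den 0
  s := Stream'.Seq.ofStream fun n => ⟨num (n + 1), den (n + 1)⟩

/-- A generalised continued fraction converges to `y`: its convergents are defined from some
index on (their denominators do not vanish) and they tend to `y`. -/
def CFConvergesTo (g : GenContFract ℝ) (y : ℝ) : Prop :=
  (∀ᶠ n in atTop, g.dens n ≠ 0) ∧ Tendsto g.convs atTop (𝓝 y)

/-- The `i`-th partial numerator (`1 ≤ i`) of the continued fraction attached to the equation
`y ^ 3 - t * y ^ 2 - a = 0`. Here `k = ⌊i / 4⌋`. -/
def cubicNum (a : ℤ) (i : ℕ) : ℤ :=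
  let k : ℤ := ((i / 4 : ℕ) : ℤ)
  match i % 4 with
  | 1 => 3 * (12 * k + 1) * (3 * k + 1) * a
  | 2 => 3 * (12 * k + 5) * (3 * k + 2) * a
  | 3 => 3 * (12 * k + 7) * (6 * k + 5) * a
  | _ => 3 * (12 * k - 1) * (6 * k + 1) * a

/-- The `i`-th partial denominator (`0 ≤ i`) of the continued fraction attached to the equation
`y ^ 3 - t * y ^ 2 - a = 0`; in particular `cubicDen t 0 = t`. -/
def cubicDen (t : ℤ) (i : ℕ) : ℤ :=
  match i % 4 with
  | 1 => (2 * (i : ℤ) + 1) * t ^ 2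
  | 2 => (2 * (i : ℤ) + 1) * t
  | 3 => 2 * (2 * (i : ℤ) + 1) * t ^ 2
  | _ => (2 * (i : ℤ) + 1) * t

/-- The closed-form continued fraction attached to `y ^ 3 - t * y ^ 2 - a = 0`. -/
def cubicCF (a t : ℤ) : GenContFract ℝ :=
  contFrac (fun i => (cubicNum a i : ℝ)) (fun i => (cubicDen t i : ℝ))

/-- Partial numerators of the continued fraction `mobiusCubicCF`. -/
def mobiusCubicNum (u v w z a : ℤ) : ℕ → ℝ
  | 0 => 1
  | 1 => v * w - u * z
  | 2 => w ^ 2 * cubicNum a 1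
  | n + 3 => cubicNum a (n + 2)

/-- Partial denominators of the continued fraction `mobiusCubicCF`. -/
def mobiusCubicDen (u w z t : ℤ) : ℕ → ℝ
  | 0 => u / w
  | 1 => w * z + w ^ 2 * t
  | n + 2 => cubicDen t (n + 1)

/-- The continued fraction of `(u * y + v) / (w * y + z)`, `w ≠ 0`, obtained from the
closed-form one `t + β₁ / (a₁ + β₂ / (a₂ + ⋯))` of `y`, namely
`u / w + (v * w - u * z) / (w * z + w ^ 2 * t + w ^ 2 * β₁ / (a₁ + β₂ / (a₂ + ⋯)))`. -/
def mobiusCubicCF (u v w z a t : ℤ) : GenContFract ℝ :=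
  contFrac (mobiusCubicNum u v w z a) (mobiusCubicDen u w z t)

end

/-! ### Convergents of `contFrac` -/

/-! Put `y = t * f` and `s = α / t ^ 3`, so that the equation becomes `f ^ 3 - f ^ 2 = s`. With `z =
-27 / 4 * s`, its root near 1 is `U / V`, where `U = F(1/6, -1/6; 1/2; z)` and `V = F(1/6, 5/6; 3/2;
z)` are Gauss hypergeometric series. Classically, for `z = sin² θ`, these are `cos (θ/3)` and `3 sin
(2θ/3) / (2 sin θ)`, and the cubic is the trisection formula. Here it is proved formally, from a
first-order linear differential system for `U` and `V` (`gaussSeries_cubic`).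

Gauss's contiguity relation places `U` and `V` at the head of a sequence `g i` of hypergeometric
values with `den i * den (i + 1) * (g i - g (i + 1)) = num (i + 1) * g (i + 2)`, where `num` and
`den` are the elements of `K(α, t)` (`cubicTail_recurrence`). Thus `den i * g i / g (i + 1)` is
formally the value of the `i`-th tail, and the whole fraction should be `t * U / V = y`. When `s` is
small the elements satisfy a smallness condition that forces geometric convergence
(`CFConvergesTo.of_tails`, `cubicCF_convergesTo`).

It remains to move an arbitrary cubic irrational by a Möbius map to a root `y` with `y / t` close to
1 (`exists_rat_reduction`). After a shift, `w ^ 3 + P * w + Q = 0`. The element `z = 3 * w ^ 2 + A *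
w + 2 * P` has trace zero, so `z ^ 3 + p * z + q = 0`, and `y = 1 / z` satisfies an equation of the
required shape with `y / t - 1 = z ^ 2 / p`. A rational `A` can be chosen to make `z` as small as
desired, and `1 / z` is a Möbius image of `w`. Undoing the Möbius map on convergents gives the
fraction for `x` (`CFConvergesTo.mobius`). -/

lemma contFrac_nums_zero (num den : ℕ → ℝ) : (contFrac num den).nums 0 = den 0 :=
  GenContFract.zeroth_num_eq_h

lemma contFrac_dens_zero (num den : ℕ → ℝ) : (contFrac num den).dens 0 = 1 :=
  GenContFract.zeroth_den_eq_one

lemma contFrac_get? (num den : ℕ → ℝ) (n : ℕ) :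
    (contFrac num den).s.get? n = some ⟨num (n + 1), den (n + 1)⟩ := rfl

lemma contFrac_nums_one (num den : ℕ → ℝ) :
    (contFrac num den).nums 1 = den 1 * den 0 + num 1 :=
  GenContFract.first_num_eq (contFrac_get? num den 0)

lemma contFrac_dens_one (num den : ℕ → ℝ) : (contFrac num den).dens 1 = den 1 :=
  GenContFract.first_den_eq (contFrac_get? num den 0)

lemma contFrac_nums_add_two (num den : ℕ → ℝ) (n : ℕ) :
    (contFrac num den).nums (n + 2) =
      den (n + 2) * (contFrac num den).nums (n + 1) + num (n + 2) * (contFrac num den).nums n :=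
  GenContFract.nums_recurrence (contFrac_get? num den (n + 1)) rfl rfl

lemma contFrac_dens_add_two (num den : ℕ → ℝ) (n : ℕ) :
    (contFrac num den).dens (n + 2) =
      den (n + 2) * (contFrac num den).dens (n + 1) + num (n + 2) * (contFrac num den).dens n :=
  GenContFract.dens_recurrence (contFrac_get? num den (n + 1)) rfl rfl

/-- Convergence of the convergents through the remainders `nums n - y * dens n`. -/
lemma CFConvergesTo.of_remainder {num den : ℕ → ℝ} {y : ℝ} (e : ℕ → ℝ)
    (he : Tendsto e atTop (𝓝 0)) (hd : ∀ n, (contFrac num den).dens n ≠ 0)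
    (hle : ∀ n, |(contFrac num den).nums n - y * (contFrac num den).dens n| ≤
      e n * |(contFrac num den).dens n|) :
    CFConvergesTo (contFrac num den) y := by
  refine ⟨Eventually.of_forall hd, ?_⟩
  change Tendsto (fun n : ℕ => (contFrac num den).convs n) atTop (𝓝 y)
  rw [tendsto_iff_dist_tendsto_zero]
  refine squeeze_zero (fun _ => dist_nonneg) (fun n => ?_) he
  have h := hd n
  have hp := abs_pos.2 h
  rw [Real.dist_eq, GenContFract.conv_eq_num_div_den]
  have : (contFrac num den).nums n / (contFrac num den).dens n - y =
      ((contFrac num den).nums n - y * (contFrac num den).dens n) /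
        (contFrac num den).dens n := by
    field_simp
  rw [this, abs_div, div_le_iff₀ hp]
  exact hle n

/-- The denominators of the convergents grow at least like `2 ^ (-n) * ∏ |den i|`. -/
lemma contFrac_dens_lower {num den : ℕ → ℝ} (hden : ∀ i, den i ≠ 0)
    (hc : ∀ i, |num (i + 1)| ≤ |den i * den (i + 1)| / 16) (n : ℕ) :
    0 < |(contFrac num den).dens n| ∧
      |den (n + 1)| * |(contFrac num den).dens n| ≤ 2 * |(contFrac num den).dens (n + 1)| := by
  induction n with
  | zero =>
    rw [contFrac_dens_zero, contFrac_dens_one]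
    have := abs_nonneg (den 1)
    norm_num
    linarith
  | succ n ih =>
    obtain ⟨h0, h1⟩ := ih
    have hd1 := abs_pos.2 (hden (n + 1))
    have hd2 := abs_pos.2 (hden (n + 2))
    have hpos : 0 < |(contFrac num den).dens (n + 1)| := by
      have := mul_pos hd1 h0
      linarith
    refine ⟨hpos, ?_⟩
    rw [contFrac_dens_add_two]
    have hcn := hc (n + 1)
    rw [abs_mul] at hcn
    have h2 : |num (n + 2) * (contFrac num den).dens n| ≤
        |den (n + 2)| * |(contFrac num den).dens (n + 1)| / 8 := by
      rw [abs_mul]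
      calc |num (n + 2)| * |(contFrac num den).dens n|
          ≤ (|den (n + 1)| * |den (n + 2)| / 16) * |(contFrac num den).dens n| := by gcongr
        _ = |den (n + 2)| / 16 * (|den (n + 1)| * |(contFrac num den).dens n|) := by ring
        _ ≤ |den (n + 2)| / 16 * (2 * |(contFrac num den).dens (n + 1)|) := by gcongr
        _ = _ := by ring
    -- The second term of the recurrence is at most 1/8 of the first, so at least 7/8 of the first
    -- survives; 1/2 is all that is needed.
    have h3 := abs_sub_abs_le_abs_sub (den (n + 2) * (contFrac num den).dens (n + 1))
      (-(num (n + 2) * (contFrac num den).dens n))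
    rw [abs_neg, sub_neg_eq_add, abs_mul] at h3
    have h4 : 0 ≤ |den (n + 2)| * |(contFrac num den).dens (n + 1)| := by positivity
    have h5 : n + 1 + 1 = n + 2 := rfl
    rw [h5]
    linarith

/-- Remainders of the convergents in terms of a solution `g` of the tail recurrence. -/
lemma contFrac_remainder {num den g : ℕ → ℝ} (hden : ∀ i, den i ≠ 0)
    (hrec : ∀ i, den i * den (i + 1) * (g i - g (i + 1)) = num (i + 1) * g (i + 2))
    (n : ℕ) :
    (contFrac num den).nums n * g 1 - den 0 * g 0 * (contFrac num den).dens n =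
      (∏ j ∈ Finset.range (n + 1), (-(num (j + 1) / den (j + 1)))) * g (n + 2) := by
  induction n using Nat.twoStepInduction with
  | zero =>
    rw [contFrac_nums_zero, contFrac_dens_zero, Finset.prod_range_one]
    have h1 := hden 1
    have := hrec 0
    norm_num at this ⊢
    field_simp
    linear_combination -this
  | one =>
    rw [contFrac_nums_one, contFrac_dens_one, Finset.prod_range_succ, Finset.prod_range_one]
    have h1 := hden 1
    have h2 := hden 2
    have e0 := hrec 0
    have e1 := hrec 1
    norm_num at e0 e1 ⊢
    field_simp
    linear_combination (-den 1 * den 2) * e0 + num 1 * e1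
  | more n ih0 ih1 =>
    rw [contFrac_nums_add_two, contFrac_dens_add_two]
    have h2 := hden (n + 2)
    have h3 := hden (n + 3)
    have e2 := hrec (n + 2)
    rw [Finset.prod_range_succ] at ih1
    rw [Finset.prod_range_succ, Finset.prod_range_succ]
    set p := ∏ j ∈ Finset.range (n + 1), (-(num (j + 1) / den (j + 1)))
    have key : (den (n + 2) * (contFrac num den).nums (n + 1) +
          num (n + 2) * (contFrac num den).nums n) * g 1 -
        den 0 * g 0 * (den (n + 2) * (contFrac num den).dens (n + 1) +
          num (n + 2) * (contFrac num den).dens n) =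
        den (n + 2) * (p * -(num (n + 2) / den (n + 2)) * g (n + 3)) +
          num (n + 2) * (p * g (n + 2)) := by
      linear_combination den (n + 2) * ih1 + num (n + 2) * ih0
    rw [key]
    have e3 : g (n + 2) - g (n + 3) = num (n + 3) * g (n + 4) / (den (n + 2) * den (n + 3)) := by
      rw [eq_div_iff (mul_ne_zero h2 h3)]
      linear_combination e2
    have h4 : p * num (n + 2) * (g (n + 2) - g (n + 3)) =
        p * num (n + 2) * (num (n + 3) * g (n + 4) / (den (n + 2) * den (n + 3))) := by rw [e3]
    have e5 : n + 2 + 2 = n + 4 := rfl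
    have e6 : n + 2 + 1 = n + 3 := rfl
    have e7 : n + 1 + 1 = n + 2 := rfl
    rw [e5, e6, e7]
    have h5 : den (n + 2) * (p * -(num (n + 2) / den (n + 2)) * g (n + 3)) +
        num (n + 2) * (p * g (n + 2)) = p * num (n + 2) * (g (n + 2) - g (n + 3)) := by
      field_simp
      ring
    rw [h5, h4]
    field_simp

/-- A continued fraction with small elements converges to the value given by a solution of the
tail recurrence that grows at most like `2 ^ i`. -/
theorem CFConvergesTo.of_tails {num den g : ℕ → ℝ} {C : ℝ} (hden : ∀ i, den i ≠ 0)
    (hc : ∀ i, |num (i + 1)| ≤ |den i * den (i + 1)| / 16)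
    (hrec : ∀ i, den i * den (i + 1) * (g i - g (i + 1)) = num (i + 1) * g (i + 2))
    (hg1 : g 1 ≠ 0) (hg : ∀ i, |g i| ≤ C * 2 ^ i) :
    CFConvergesTo (contFrac num den) (den 0 * g 0 / g 1) := by
  have hlow := contFrac_dens_lower hden hc
  have hC : 0 ≤ C := by simpa using (abs_nonneg _).trans (hg 0)
  -- Each new factor is at most `|den (n + 1)| / 16`, and the growth of `dens` absorbs `|den (n +
  -- 1)|` at the cost of a factor 2: a net gain of 1/8 per step. Against the growth `2 ^ n` of `g`
  -- this leaves `(1 / 4) ^ n`.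
  have hprod : ∀ n, |∏ j ∈ Finset.range (n + 1), (-(num (j + 1) / den (j + 1)))| ≤
      |den 0| / 16 * (1 / 8) ^ n * |(contFrac num den).dens n| := by
    intro n
    induction n with
    | zero =>
      have h1 := abs_pos.2 (hden 1)
      have := hc 0
      rw [contFrac_dens_zero, Finset.prod_range_one, abs_neg, abs_div, div_le_iff₀ h1]
      rw [abs_mul] at this
      norm_num at this ⊢
      linarith
    | succ n ih =>
      have h1 := abs_pos.2 (hden (n + 1))
      have h2 := abs_pos.2 (hden (n + 2))
      have hq : |num (n + 2) / den (n + 2)| ≤ |den (n + 1)| / 16 := by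
        have := hc (n + 1)
        rw [abs_mul] at this
        rw [abs_div, div_le_iff₀ h2]
        calc |num (n + 2)| ≤ |den (n + 1)| * |den (n + 2)| / 16 := this
          _ = _ := by ring
      rw [Finset.prod_range_succ, abs_mul, abs_neg]
      calc _ ≤ (|den 0| / 16 * (1 / 8) ^ n * |(contFrac num den).dens n|) *
            (|den (n + 1)| / 16) := by gcongr
        _ = |den 0| / 16 * (1 / 8) ^ n / 16 *
            (|den (n + 1)| * |(contFrac num den).dens n|) := by ring
        _ ≤ |den 0| / 16 * (1 / 8) ^ n / 16 * (2 * |(contFrac num den).dens (n + 1)|) := by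
            exact mul_le_mul_of_nonneg_left (hlow n).2 (by positivity)
        _ = _ := by ring
  have hg1' := abs_pos.2 hg1
  refine CFConvergesTo.of_remainder
    (fun n => |den 0| / 16 * C * 4 / |g 1| * (1 / 4) ^ n) ?_ (fun n => abs_pos.1 (hlow n).1) ?_
  · simpa using (tendsto_pow_atTop_nhds_zero_of_lt_one (r := (1 / 4 : ℝ)) (by norm_num)
      (by norm_num)).const_mul (|den 0| / 16 * C * 4 / |g 1|)
  · intro n
    have hR := contFrac_remainder hden hrec n
    have e : (contFrac num den).nums n - den 0 * g 0 / g 1 * (contFrac num den).dens n =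
        (∏ j ∈ Finset.range (n + 1), (-(num (j + 1) / den (j + 1)))) * g (n + 2) / g 1 := by
      rw [← hR]
      field_simp
    rw [e, abs_div, abs_mul]
    calc _ ≤ (|den 0| / 16 * (1 / 8) ^ n * |(contFrac num den).dens n|) *
          (C * 2 ^ (n + 2)) / |g 1| := by
          gcongr
          · exact hprod n
          · exact hg (n + 2)
      _ = |den 0| / 16 * C * 4 / |g 1| * ((1 / 8) ^ n * 2 ^ n) *
          |(contFrac num den).dens n| := by
          rw [pow_add]
          ring
      _ = _ := by
          rw [← mul_pow]
          norm_num

/-! ### Möbius images -/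

/-- This rests on `(u y + v) / (w y + z) = u / w + (v w - u z) / (w (w y + z))`. The extra term `u /
w` shifts the index by one. The common factor `w` in numerators and denominators cancels in the
convergents. -/
lemma mobiusCubicCF_nums (u v w z a t : ℤ) (hw : w ≠ 0) (n : ℕ) :
    (mobiusCubicCF u v w z a t).nums (n + 1) =
      w * (u * (cubicCF a t).nums n + v * (cubicCF a t).dens n) := by
  have hw' : (w : ℝ) ≠ 0 := by exact_mod_cast hw
  unfold mobiusCubicCF cubicCF
  induction n using Nat.twoStepInduction with
  | zero =>
    rw [contFrac_nums_one, contFrac_nums_zero, contFrac_dens_zero]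
    simp only [mobiusCubicNum, mobiusCubicDen, cubicDen]
    push_cast
    field_simp
    ring
  | one =>
    rw [contFrac_nums_add_two, contFrac_nums_one, contFrac_nums_zero, contFrac_nums_one,
      contFrac_dens_one]
    simp only [mobiusCubicNum, mobiusCubicDen, cubicDen]
    push_cast
    field_simp
    ring
  | more n ih0 ih1 =>
    rw [contFrac_nums_add_two, ih0, ih1, contFrac_nums_add_two _ _ n,
      contFrac_dens_add_two _ _ n]
    simp only [mobiusCubicNum, mobiusCubicDen]
    ring

lemma mobiusCubicCF_dens (u v w z a t : ℤ) (hw : w ≠ 0) (n : ℕ) :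
    (mobiusCubicCF u v w z a t).dens (n + 1) =
      w * (w * (cubicCF a t).nums n + z * (cubicCF a t).dens n) := by
  have hw' : (w : ℝ) ≠ 0 := by exact_mod_cast hw
  unfold mobiusCubicCF cubicCF
  induction n using Nat.twoStepInduction with
  | zero =>
    rw [contFrac_dens_one, contFrac_nums_zero, contFrac_dens_zero]
    simp only [mobiusCubicDen, cubicDen]
    push_cast
    norm_num
    ring
  | one =>
    rw [contFrac_dens_add_two, contFrac_dens_zero, contFrac_dens_one, contFrac_nums_one,
      contFrac_dens_one]
    simp only [mobiusCubicNum, mobiusCubicDen, cubicDen]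
    push_cast
    norm_num
    ring
  | more n ih0 ih1 =>
    rw [contFrac_dens_add_two, ih0, ih1, contFrac_nums_add_two _ _ n,
      contFrac_dens_add_two _ _ n]
    simp only [mobiusCubicNum, mobiusCubicDen]
    ring

theorem CFConvergesTo.mobius {u v w z a t : ℤ} {y : ℝ} (h : CFConvergesTo (cubicCF a t) y)
    (hw : w ≠ 0) (hy : w * y + z ≠ 0) :
    CFConvergesTo (mobiusCubicCF u v w z a t) ((u * y + v) / (w * y + z)) := by
  have hw' : (w : ℝ) ≠ 0 := by exact_mod_cast hw
  obtain ⟨hd, hlim⟩ := h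
  have hden : Tendsto (fun n => (w : ℝ) * (cubicCF a t).convs n + z) atTop (𝓝 (w * y + z)) :=
    (hlim.const_mul _).add_const _
  have hnum : Tendsto (fun n => (u : ℝ) * (cubicCF a t).convs n + v) atTop (𝓝 (u * y + v)) :=
    (hlim.const_mul _).add_const _
  have hne := hden.eventually_ne hy
  constructor
  · rw [← map_add_atTop_eq_nat 1, eventually_map]
    filter_upwards [hd, hne] with n hn hn'
    rw [GenContFract.conv_eq_num_div_den] at hn'
    rw [mobiusCubicCF_dens _ _ _ _ _ _ hw]
    -- A vanishing denominator would make `w * convs n + z` zero, although it tends to `w * y + z ≠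
    -- 0`.
    refine mul_ne_zero hw' fun h0 => hn' ?_
    field_simp
    linear_combination h0
  · change Tendsto (fun n : ℕ => (mobiusCubicCF u v w z a t).convs n) atTop _
    rw [← tendsto_add_atTop_iff_nat 1]
    refine (hnum.div hden hy).congr' ?_
    filter_upwards [hd, hne] with n hn hn'
    rw [GenContFract.conv_eq_num_div_den, mobiusCubicCF_nums _ _ _ _ _ _ hw,
      mobiusCubicCF_dens _ _ _ _ _ _ hw, mul_div_mul_left _ _ hw']
    simp only [Pi.div_apply, GenContFract.conv_eq_num_div_den]
    rw [GenContFract.conv_eq_num_div_den] at hn'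
    field_simp

noncomputable section

/-! ### Evaluating power series -/

/-- The coefficients of `p` are absolutely summable against the powers of `z`. -/
def AbsSummableAt (z : ℝ) (p : PowerSeries ℝ) : Prop :=
  Summable fun k => ‖PowerSeries.coeff k p * z ^ k‖

/-- The value at `z` of a power series. -/
def seriesEval (z : ℝ) (p : PowerSeries ℝ) : ℝ := ∑' k, PowerSeries.coeff k p * z ^ k

lemma coeff_mul_mul_pow (z : ℝ) (p q : PowerSeries ℝ) (k : ℕ) :
    PowerSeries.coeff k (p * q) * z ^ k =
      ∑ ij ∈ Finset.HasAntidiagonal.antidiagonal k,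
        (PowerSeries.coeff ij.1 p * z ^ ij.1) * (PowerSeries.coeff ij.2 q * z ^ ij.2) := by
  rw [PowerSeries.coeff_mul, Finset.sum_mul]
  refine Finset.sum_congr rfl fun ij hij => ?_
  rw [← Finset.HasAntidiagonal.mem_antidiagonal.1 hij, pow_add]
  ring

lemma AbsSummableAt.mul {z : ℝ} {p q : PowerSeries ℝ} (hp : AbsSummableAt z p)
    (hq : AbsSummableAt z q) : AbsSummableAt z (p * q) := by
  refine (summable_norm_sum_mul_antidiagonal_of_summable_norm hp hq).congr fun k => ?_
  rw [coeff_mul_mul_pow]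

lemma seriesEval_mul {z : ℝ} {p q : PowerSeries ℝ} (hp : AbsSummableAt z p)
    (hq : AbsSummableAt z q) : seriesEval z (p * q) = seriesEval z p * seriesEval z q := by
  unfold seriesEval
  simp only [coeff_mul_mul_pow]
  exact (tsum_mul_tsum_eq_tsum_sum_antidiagonal_of_summable_norm hp hq).symm

lemma AbsSummableAt.add {z : ℝ} {p q : PowerSeries ℝ} (hp : AbsSummableAt z p)
    (hq : AbsSummableAt z q) : AbsSummableAt z (p + q) := by
  refine Summable.of_nonneg_of_le (fun _ => norm_nonneg _) (fun k => ?_) (Summable.add hp hq)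
  rw [map_add, add_mul]
  exact norm_add_le _ _

lemma seriesEval_add {z : ℝ} {p q : PowerSeries ℝ} (hp : AbsSummableAt z p)
    (hq : AbsSummableAt z q) : seriesEval z (p + q) = seriesEval z p + seriesEval z q := by
  unfold seriesEval
  simp_rw [map_add, add_mul]
  exact Summable.tsum_add hp.of_norm hq.of_norm

lemma absSummableAt_monomial (z : ℝ) (n : ℕ) (r : ℝ) :
    AbsSummableAt z (PowerSeries.monomial n r) := by
  refine summable_of_ne_finset_zero (s := {n}) fun k hk => ?_
  rw [PowerSeries.coeff_monomial, if_neg (by simpa using hk)]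
  simp

lemma seriesEval_monomial (z : ℝ) (n : ℕ) (r : ℝ) :
    seriesEval z (PowerSeries.monomial n r) = r * z ^ n := by
  unfold seriesEval
  rw [tsum_eq_single n, PowerSeries.coeff_monomial, if_pos rfl]
  intro k hk
  rw [PowerSeries.coeff_monomial, if_neg hk, zero_mul]

lemma absSummableAt_X (z : ℝ) : AbsSummableAt z PowerSeries.X := by
  rw [PowerSeries.X_eq]
  exact absSummableAt_monomial _ _ _

lemma seriesEval_X (z : ℝ) : seriesEval z PowerSeries.X = z := by
  rw [PowerSeries.X_eq, seriesEval_monomial, one_mul, pow_one]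

lemma absSummableAt_C (z r : ℝ) : AbsSummableAt z (PowerSeries.C r) := by
  rw [← PowerSeries.monomial_zero_eq_C_apply]
  exact absSummableAt_monomial _ _ _

lemma seriesEval_C (z r : ℝ) : seriesEval z (PowerSeries.C r) = r := by
  rw [← PowerSeries.monomial_zero_eq_C_apply, seriesEval_monomial, pow_zero, mul_one]

/-! ### Hypergeometric series -/

/-- The rising factorial `a (a + 1) ⋯ (a + k - 1)`. -/
def risingFactorial (a : ℝ) (k : ℕ) : ℝ := ∏ j ∈ Finset.range k, (a + j)

lemma risingFactorial_zero (a : ℝ) : risingFactorial a 0 = 1 := rfl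

lemma risingFactorial_succ (a : ℝ) (k : ℕ) :
    risingFactorial a (k + 1) = risingFactorial a k * (a + k) :=
  Finset.prod_range_succ _ _

lemma risingFactorial_succ' (a : ℝ) (k : ℕ) :
    risingFactorial a (k + 1) = a * risingFactorial (a + 1) k := by
  unfold risingFactorial
  rw [Finset.prod_range_succ', mul_comm]
  congr 1
  · simp
  · refine Finset.prod_congr rfl fun j _ => ?_
    push_cast
    ring

lemma risingFactorial_pos {a : ℝ} (ha : 0 < a) (k : ℕ) : 0 < risingFactorial a k :=
  Finset.prod_pos fun _ _ => by positivity

lemma abs_risingFactorial_le {a b : ℝ} (h : |a| ≤ b) (k : ℕ) :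
    |risingFactorial a k| ≤ risingFactorial b k := by
  unfold risingFactorial
  rw [Finset.abs_prod]
  refine Finset.prod_le_prod (fun _ _ => abs_nonneg _) fun j _ => ?_
  refine (abs_add_le _ _).trans ?_
  rw [Nat.abs_cast]
  gcongr

lemma risingFactorial_natCast (m k : ℕ) :
    risingFactorial (m + 1) k = (m + k).choose k * k.factorial := by
  induction k with
  | zero => simp [risingFactorial_zero]
  | succ k ih =>
    rw [risingFactorial_succ, ih]
    have h := Nat.add_one_mul_choose_eq (m + k) k
    rw [Nat.factorial_succ, ← add_assoc]
    have h' : ((m : ℝ) + k + 1) * (m + k).choose k = (m + k + 1).choose (k + 1) * (k + 1) := by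
      exact_mod_cast h
    push_cast
    linear_combination (k.factorial : ℝ) * h'

/-- The coefficients of the Gauss hypergeometric series. -/
def gaussCoeff (a b c : ℝ) (k : ℕ) : ℝ :=
  risingFactorial a k * risingFactorial b k / (risingFactorial c k * k.factorial)

lemma gaussCoeff_zero (a b c : ℝ) : gaussCoeff a b c 0 = 1 := by
  simp [gaussCoeff, risingFactorial_zero]

lemma gaussCoeff_symm (a b c : ℝ) (k : ℕ) : gaussCoeff a b c k = gaussCoeff b a c k := by
  unfold gaussCoeff
  rw [mul_comm (risingFactorial a k)]

lemma gaussCoeff_succ (a b : ℝ) {c : ℝ} (hc : 0 < c) (k : ℕ) :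
    (c + k) * (k + 1) * gaussCoeff a b c (k + 1) = (a + k) * (b + k) * gaussCoeff a b c k := by
  unfold gaussCoeff
  have h := (risingFactorial_pos hc k).ne'
  have h1 : c + k ≠ 0 := by positivity
  rw [risingFactorial_succ, risingFactorial_succ, risingFactorial_succ, Nat.factorial_succ]
  push_cast
  field_simp

/-- The contiguity relation behind the continued fraction of Gauss. -/
lemma gaussCoeff_contiguous (a b : ℝ) {c : ℝ} (hc : 0 < c) (k : ℕ) :
    c * (c + 1) * (gaussCoeff a b c (k + 1) - gaussCoeff a (b + 1) (c + 1) (k + 1)) =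
      -(a * (c - b)) * gaussCoeff (a + 1) (b + 1) (c + 2) k := by
  have h2 := (risingFactorial_pos (by positivity : 0 < c + 2) k).ne'
  have h3 : c + 1 + k ≠ 0 := by positivity
  have hc0 := hc.ne'
  have hc1 : c + 1 ≠ 0 := by positivity
  have e1 : risingFactorial (c + 1) (k + 1) = (c + 1) * risingFactorial (c + 2) k := by
    rw [risingFactorial_succ', show c + 1 + 1 = c + 2 by ring]
  -- All lower rising factorials are expressed through `(c + 2)_k`, which then cancels and leaves a
  -- rational identity.
  have e2 : risingFactorial c (k + 1) =
      c * (c + 1) * risingFactorial (c + 2) k / (c + 1 + k) := by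
    rw [eq_div_iff h3, risingFactorial_succ', mul_assoc, ← risingFactorial_succ, e1, mul_assoc]
  unfold gaussCoeff
  rw [e1, e2, risingFactorial_succ' a, risingFactorial_succ' b, risingFactorial_succ (b + 1),
    Nat.factorial_succ]
  push_cast
  field_simp
  ring

/-- The factor `(b)_k / (c)_k` is at most 1 in absolute value, and `(m + 1)_k / k!` is a binomial
coefficient. -/
lemma abs_gaussCoeff_le {a b c : ℝ} {m : ℕ} (ha : |a| ≤ m + 1) (hb : |b| ≤ c) (hc : 0 < c)
    (k : ℕ) : |gaussCoeff a b c k| ≤ (m + k).choose k := by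
  have h := risingFactorial_pos hc k
  unfold gaussCoeff
  rw [abs_div, abs_mul, abs_of_pos (by positivity : 0 < risingFactorial c k * (k.factorial : ℝ)),
    div_le_iff₀ (by positivity)]
  calc _ ≤ risingFactorial (m + 1) k * risingFactorial c k := by
        gcongr
        · exact (abs_nonneg _).trans (abs_risingFactorial_le ha k)
        · exact abs_risingFactorial_le ha k
        · exact abs_risingFactorial_le hb k
    _ = _ := by
        rw [risingFactorial_natCast]
        ring

/-- The Gauss hypergeometric series. -/
def gaussSeries (a b c : ℝ) : PowerSeries ℝ := PowerSeries.mk (gaussCoeff a b c)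

/-- The binomial bound `2 ^ (m + k)` against `|z| ≤ 1 / 4` leaves ratio 1/2. The dependence on the
parameters is only `2 ^ m`, which keeps the tails within the growth allowed by
`CFConvergesTo.of_tails`. -/
lemma abs_gaussCoeff_mul_pow_le {a b c z : ℝ} {m : ℕ} (ha : |a| ≤ m + 1) (hb : |b| ≤ c)
    (hc : 0 < c) (hz : |z| ≤ 1 / 4) (k : ℕ) :
    ‖PowerSeries.coeff k (gaussSeries a b c) * z ^ k‖ ≤ 2 ^ m * (1 / 2) ^ k := by
  rw [gaussSeries, PowerSeries.coeff_mk, norm_mul, norm_pow, Real.norm_eq_abs, Real.norm_eq_abs]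
  have h1 : ((m + k).choose k : ℝ) ≤ 2 ^ (m + k) := by exact_mod_cast Nat.choose_le_two_pow _ _
  calc _ ≤ (2 : ℝ) ^ (m + k) * (1 / 4) ^ k := by
        gcongr
        exact (abs_gaussCoeff_le ha hb hc k).trans h1
    _ = 2 ^ m * (2 ^ k * (1 / 4) ^ k) := by ring
    _ = _ := by
        rw [← mul_pow]
        norm_num

lemma absSummableAt_gaussSeries {a b c z : ℝ} {m : ℕ} (ha : |a| ≤ m + 1) (hb : |b| ≤ c)
    (hc : 0 < c) (hz : |z| ≤ 1 / 4) : AbsSummableAt z (gaussSeries a b c) :=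
  Summable.of_nonneg_of_le (fun _ => norm_nonneg _) (abs_gaussCoeff_mul_pow_le ha hb hc hz)
    (summable_geometric_two.mul_left _)

lemma abs_seriesEval_gaussSeries_le {a b c z : ℝ} {m : ℕ} (ha : |a| ≤ m + 1) (hb : |b| ≤ c)
    (hc : 0 < c) (hz : |z| ≤ 1 / 4) : |seriesEval z (gaussSeries a b c)| ≤ 2 * 2 ^ m := by
  have h : ‖seriesEval z (gaussSeries a b c)‖ ≤ ∑' k : ℕ, (2 : ℝ) ^ m * (1 / 2) ^ k :=
    tsum_of_norm_bounded (summable_geometric_two.mul_left ((2 : ℝ) ^ m)).hasSum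
      (abs_gaussCoeff_mul_pow_le ha hb hc hz)
  rwa [tsum_mul_left, tsum_geometric_two, mul_comm, Real.norm_eq_abs] at h

/-- For `m = 0` the coefficients are bounded by 1, and `∑ 16 ^ (-k)` over `k ≥ 1` is 1/15. -/
lemma abs_seriesEval_gaussSeries_sub_one_le {a b c z : ℝ} (ha : |a| ≤ 1) (hb : |b| ≤ c)
    (hc : 0 < c) (hz : |z| ≤ 1 / 16) : |seriesEval z (gaussSeries a b c) - 1| ≤ 1 / 15 := by
  have hz4 : |z| ≤ 1 / 4 := hz.trans (by norm_num)
  have hs : AbsSummableAt z (gaussSeries a b c) :=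
    absSummableAt_gaussSeries (m := 0) (by simpa using ha) hb hc hz4
  have e : seriesEval z (gaussSeries a b c) - 1 =
      ∑' k, PowerSeries.coeff (k + 1) (gaussSeries a b c) * z ^ (k + 1) := by
    unfold seriesEval
    rw [Summable.tsum_eq_zero_add hs.of_norm]
    simp [gaussSeries, gaussCoeff_zero]
  have hsum : HasSum (fun k : ℕ => (1 / 16 : ℝ) * (1 / 16) ^ k) (1 / 15) := by
    have := (hasSum_geometric_of_lt_one (r := (1 / 16 : ℝ)) (by norm_num)
      (by norm_num)).mul_left (1 / 16)
    norm_num at this ⊢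
    exact this
  rw [e, ← Real.norm_eq_abs]
  refine tsum_of_norm_bounded hsum fun k => ?_
  rw [gaussSeries, PowerSeries.coeff_mk, norm_mul, norm_pow, Real.norm_eq_abs, Real.norm_eq_abs]
  have h1 := abs_gaussCoeff_le (m := 0) (by simpa using ha) hb hc (k + 1)
  rw [zero_add, Nat.choose_self, Nat.cast_one] at h1
  calc _ ≤ 1 * (1 / 16 : ℝ) ^ (k + 1) := by gcongr
    _ = _ := by ring

lemma seriesEval_gaussSeries_symm (a b c z : ℝ) :
    seriesEval z (gaussSeries a b c) = seriesEval z (gaussSeries b a c) := by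
  rw [gaussSeries, gaussSeries, funext (gaussCoeff_symm a b c)]

open PowerSeries in
lemma gaussSeries_contiguous (a b : ℝ) {c : ℝ} (hc : 0 < c) :
    C (c * (c + 1)) * gaussSeries a b c =
      C (c * (c + 1)) * gaussSeries a (b + 1) (c + 1) +
      C (-(a * (c - b))) * (X * gaussSeries (a + 1) (b + 1) (c + 2)) := by
  ext k
  cases k with
  | zero => simp [gaussSeries, gaussCoeff_zero]
  | succ k =>
    simp only [gaussSeries, map_add, coeff_C_mul, coeff_succ_X_mul, coeff_mk]
    linear_combination gaussCoeff_contiguous a b hc k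

lemma seriesEval_contiguous {a b c z : ℝ} {m : ℕ} (ha : |a| ≤ m + 1) (hb : |b| ≤ c)
    (hb' : |b + 1| ≤ c + 1) (ha2 : |a + 1| ≤ (m + 1 : ℕ) + 1) (hb2 : |b + 1| ≤ c + 2)
    (hc : 0 < c) (hz : |z| ≤ 1 / 4) :
    c * (c + 1) * (seriesEval z (gaussSeries a b c) -
        seriesEval z (gaussSeries a (b + 1) (c + 1))) =
      -(a * (c - b)) * z * seriesEval z (gaussSeries (a + 1) (b + 1) (c + 2)) := by
  have h0 := absSummableAt_gaussSeries ha hb hc hz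
  have h1 := absSummableAt_gaussSeries (c := c + 1) ha hb' (by positivity) hz
  have h2 := absSummableAt_gaussSeries (c := c + 2) ha2 hb2 (by positivity) hz
  have hX := absSummableAt_X z
  have hC := absSummableAt_C z
  have h := congrArg (seriesEval z) (gaussSeries_contiguous a b hc)
  rw [seriesEval_add ((hC _).mul h1) ((hC _).mul (hX.mul h2)), seriesEval_mul (hC _) h0,
    seriesEval_mul (hC _) h1, seriesEval_mul (hC _) (hX.mul h2), seriesEval_mul hX h2, seriesEval_X,
    seriesEval_C, seriesEval_C] at h
  linear_combination h

/-! ### The algebraic relation -/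

/-- This termwise proportionality is what makes the derivatives of `U` and `V` combinations of `U`
and `V` themselves. -/
lemma gaussCoeff_relation (k : ℕ) :
    (1 + 2 * (k : ℝ)) * gaussCoeff (1 / 6) (5 / 6) (3 / 2) k =
      (1 - 6 * k) * gaussCoeff (1 / 6) (-1 / 6) (1 / 2) k := by
  induction k with
  | zero => simp [gaussCoeff_zero]
  | succ k ih =>
    have h1 := gaussCoeff_succ (1 / 6) (5 / 6) (by norm_num : (0 : ℝ) < 3 / 2) k
    have h2 := gaussCoeff_succ (1 / 6) (-1 / 6) (by norm_num : (0 : ℝ) < 1 / 2) k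
    have hk : (0 : ℝ) ≤ k := k.cast_nonneg
    have h3 : ((k : ℝ) + 1) * (1 + 2 * k) ≠ 0 := by positivity
    apply mul_left_cancel₀ h3
    push_cast
    linear_combination (2 * (1 + 2 * (k : ℝ))) * h1 + 2 * (1 / 6 + k) * (5 / 6 + k) * ih -
      2 * (1 - 6 * ((k : ℝ) + 1)) * h2

open PowerSeries in
lemma constantCoeff_derivative (p : PowerSeries ℝ) :
    constantCoeff (d⁄dX ℝ p) = coeff 1 p := by
  rw [← coeff_zero_eq_constantCoeff_apply, coeff_derivative]
  simp

open PowerSeries in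
lemma derivative_gaussSeries_even :
    18 * (1 - X) * d⁄dX ℝ (gaussSeries (1 / 6) (-1 / 6) (1 / 2)) =
      -3 * gaussSeries (1 / 6) (-1 / 6) (1 / 2) + 2 * gaussSeries (1 / 6) (5 / 6) (3 / 2) := by
  rw [show (18 : PowerSeries ℝ) = C 18 from (map_ofNat C 18).symm,
    show (3 : PowerSeries ℝ) = C 3 from (map_ofNat C 3).symm,
    show (2 : PowerSeries ℝ) = C 2 from (map_ofNat C 2).symm, neg_mul, mul_assoc, sub_mul,
    one_mul]
  ext k
  have hr := gaussCoeff_relation k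
  have hs := gaussCoeff_succ (1 / 6) (-1 / 6) (by norm_num : (0 : ℝ) < 1 / 2) k
  have hk : (1 + 2 * (k : ℝ)) ≠ 0 := by positivity
  have key : 18 * (gaussCoeff (1 / 6) (-1 / 6) (1 / 2) (k + 1) * (k + 1) -
      gaussCoeff (1 / 6) (-1 / 6) (1 / 2) k * k) =
      -(3 * gaussCoeff (1 / 6) (-1 / 6) (1 / 2) k) +
        2 * gaussCoeff (1 / 6) (5 / 6) (3 / 2) k := by
    apply mul_left_cancel₀ hk
    linear_combination 36 * hs - 2 * hr
  cases k with
  | zero => simpa [gaussSeries, constantCoeff_derivative, coeff_succ_X_mul,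
      -mul_eq_mul_left_iff] using key
  | succ k => simpa [gaussSeries, coeff_derivative, coeff_succ_X_mul,
      -mul_eq_mul_left_iff] using key

open PowerSeries in
lemma derivative_gaussSeries_odd :
    6 * X * (1 - X) * d⁄dX ℝ (gaussSeries (1 / 6) (5 / 6) (3 / 2)) =
      3 * gaussSeries (1 / 6) (-1 / 6) (1 / 2) - 3 * gaussSeries (1 / 6) (5 / 6) (3 / 2) +
        X * gaussSeries (1 / 6) (5 / 6) (3 / 2) := by
  rw [show (6 : PowerSeries ℝ) = C 6 from (map_ofNat C 6).symm,
    show (3 : PowerSeries ℝ) = C 3 from (map_ofNat C 3).symm, mul_assoc, mul_assoc, sub_mul,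
    one_mul]
  ext k
  cases k with
  | zero => simp [gaussSeries, gaussCoeff_zero]
  | succ k =>
    have hr1 := gaussCoeff_relation (k + 1)
    have hs := gaussCoeff_succ (1 / 6) (5 / 6) (by norm_num : (0 : ℝ) < 3 / 2) k
    have hk : (5 + 6 * (k : ℝ)) ≠ 0 := by positivity
    push_cast at hr1
    have key : 6 * (gaussCoeff (1 / 6) (5 / 6) (3 / 2) (k + 1) * (k + 1) -
        gaussCoeff (1 / 6) (5 / 6) (3 / 2) k * k) =
        3 * gaussCoeff (1 / 6) (-1 / 6) (1 / 2) (k + 1) -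
          3 * gaussCoeff (1 / 6) (5 / 6) (3 / 2) (k + 1) +
          gaussCoeff (1 / 6) (5 / 6) (3 / 2) k := by
      apply mul_left_cancel₀ hk
      linear_combination 36 * hs - 3 * hr1
    cases k with
    | zero => simpa [gaussSeries, constantCoeff_derivative, coeff_succ_X_mul,
      -mul_eq_mul_left_iff] using key
    | succ k => simpa [gaussSeries, coeff_derivative, coeff_succ_X_mul,
      -mul_eq_mul_left_iff] using key

open PowerSeries in
-- Comparing coefficients gives `e₀ = 0` and `(2 k + 1) e_k = (2 k - 3) e_{k-1}`, and `2 k + 1`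
-- never vanishes.
lemma eq_zero_of_derivative {E : PowerSeries ℝ}
    (h : 2 * X * (1 - X) * d⁄dX ℝ E = -(1 + X) * E) : E = 0 := by
  have h' : C 2 * (X * d⁄dX ℝ E) - C 2 * (X * (X * d⁄dX ℝ E)) + E + X * E = 0 := by
    rw [show C (2 : ℝ) = 2 from map_ofNat C 2]
    linear_combination h
  have hc : ∀ k, coeff k E = 0 := by
    intro k
    induction k with
    | zero => simpa using congrArg (coeff 0) h'
    | succ k ih =>
      have := congrArg (coeff (k + 1)) h'
      cases k with
      | zero =>
        simp [coeff_derivative, coeff_succ_X_mul] at this ih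
        simp [ih] at this ⊢
        linarith
      | succ k =>
        simp [coeff_derivative, coeff_succ_X_mul, ih] at this
        have hk : (2 * (k : ℝ) + 5) ≠ 0 := by positivity
        apply mul_left_cancel₀ hk
        linear_combination this
  ext k
  simp [hc k]

open PowerSeries in
lemma gaussSeries_cubic :
    27 * gaussSeries (1 / 6) (-1 / 6) (1 / 2) ^ 3 -
      27 * gaussSeries (1 / 6) (-1 / 6) (1 / 2) ^ 2 * gaussSeries (1 / 6) (5 / 6) (3 / 2) +
      4 * X * gaussSeries (1 / 6) (5 / 6) (3 / 2) ^ 3 = 0 := by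
  have hu := derivative_gaussSeries_even
  have hv := derivative_gaussSeries_odd
  set u := gaussSeries (1 / 6) (-1 / 6) (1 / 2)
  set v := gaussSeries (1 / 6) (5 / 6) (3 / 2)
  apply eq_zero_of_derivative
  have h27 : d⁄dX ℝ (27 : PowerSeries ℝ) = 0 := by
    exact_mod_cast (d⁄dX ℝ).map_natCast 27
  have h4 : d⁄dX ℝ (4 : PowerSeries ℝ) = 0 := by
    exact_mod_cast (d⁄dX ℝ).map_natCast 4
  simp only [map_add, map_sub, Derivation.leibniz, Derivation.leibniz_pow, h27, h4,
    derivative_X, smul_eq_mul, nsmul_eq_mul]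
  push_cast
  -- The multipliers are the partial derivatives of the cubic form in `u` and `v`, rescaled from the
  -- factors `18 (1 - X)` and `6 X (1 - X)` to `2 X (1 - X)`.
  linear_combination (9 * u ^ 2 * X - 6 * u * v * X) * hu + (-9 * u ^ 2 + 4 * X * v ^ 2) * hv

/-! ### Convergence of the closed-form continued fraction -/

lemma cubicDen_four_mul (t : ℤ) (m : ℕ) : cubicDen t (4 * m) = (8 * m + 1) * t := by
  have h : 4 * m % 4 = 0 := by omega
  simp only [cubicDen, h]
  push_cast
  ring

lemma cubicDen_four_mul_add_one (t : ℤ) (m : ℕ) :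
    cubicDen t (4 * m + 1) = (8 * m + 3) * t ^ 2 := by
  have h : (4 * m + 1) % 4 = 1 := by omega
  simp only [cubicDen, h]
  push_cast
  ring

lemma cubicDen_four_mul_add_two (t : ℤ) (m : ℕ) :
    cubicDen t (4 * m + 2) = (8 * m + 5) * t := by
  have h : (4 * m + 2) % 4 = 2 := by omega
  simp only [cubicDen, h]
  push_cast
  ring

lemma cubicDen_four_mul_add_three (t : ℤ) (m : ℕ) :
    cubicDen t (4 * m + 3) = 2 * (8 * m + 7) * t ^ 2 := by
  have h : (4 * m + 3) % 4 = 3 := by omega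
  simp only [cubicDen, h]
  push_cast
  ring

lemma cubicNum_four_mul (a : ℤ) (m : ℕ) :
    cubicNum a (4 * m) = 3 * (12 * m - 1) * (6 * m + 1) * a := by
  have h : 4 * m % 4 = 0 := by omega
  have h' : 4 * m / 4 = m := by omega
  simp only [cubicNum, h, h']

lemma cubicNum_four_mul_add_one (a : ℤ) (m : ℕ) :
    cubicNum a (4 * m + 1) = 3 * (12 * m + 1) * (3 * m + 1) * a := by
  have h : (4 * m + 1) % 4 = 1 := by omega
  have h' : (4 * m + 1) / 4 = m := by omega
  simp only [cubicNum, h, h']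

lemma cubicNum_four_mul_add_two (a : ℤ) (m : ℕ) :
    cubicNum a (4 * m + 2) = 3 * (12 * m + 5) * (3 * m + 2) * a := by
  have h : (4 * m + 2) % 4 = 2 := by omega
  have h' : (4 * m + 2) / 4 = m := by omega
  simp only [cubicNum, h, h']

lemma cubicNum_four_mul_add_three (a : ℤ) (m : ℕ) :
    cubicNum a (4 * m + 3) = 3 * (12 * m + 7) * (6 * m + 5) * a := by
  have h : (4 * m + 3) % 4 = 3 := by omega
  have h' : (4 * m + 3) / 4 = m := by omega
  simp only [cubicNum, h, h']

lemma exists_eq_four_mul_add (i : ℕ) :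
    ∃ m, i = 4 * m ∨ i = 4 * m + 1 ∨ i = 4 * m + 2 ∨ i = 4 * m + 3 :=
  ⟨i / 4, by omega⟩

lemma cubicDen_ne_zero {t : ℤ} (ht : t ≠ 0) (i : ℕ) : cubicDen t i ≠ 0 := by
  obtain ⟨m, rfl | rfl | rfl | rfl⟩ := exists_eq_four_mul_add i
  · rw [cubicDen_four_mul]
    exact mul_ne_zero (by positivity) ht
  · rw [cubicDen_four_mul_add_one]
    positivity
  · rw [cubicDen_four_mul_add_two]
    exact mul_ne_zero (by positivity) ht
  · rw [cubicDen_four_mul_add_three]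
    positivity

lemma abs_mul_pow_le_of_coeff_le {p q T s : ℝ} (hp : 0 ≤ p) (hpq : p ≤ 2 * q)
    (hs : |s| ≤ 1 / 500) : |p * (T * s)| ≤ |q * T| / 16 := by
  have hq : 0 ≤ q := by linarith
  rw [abs_mul, abs_mul, abs_mul, abs_of_nonneg hp, abs_of_nonneg hq]
  calc p * (|T| * |s|) ≤ 2 * q * (|T| * (1 / 500)) := by gcongr
    _ ≤ _ := by
      have := mul_nonneg hq (abs_nonneg T)
      nlinarith

lemma abs_cubicNum_le {a t : ℤ} {s : ℝ} (ha : (a : ℝ) = t ^ 3 * s) (hs : |s| ≤ 1 / 500)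
    (i : ℕ) :
    |(cubicNum a (i + 1) : ℝ)| ≤ |(cubicDen t i : ℝ) * cubicDen t (i + 1)| / 16 := by
  obtain ⟨m, rfl | rfl | rfl | rfl⟩ := exists_eq_four_mul_add i
  · have h := abs_mul_pow_le_of_coeff_le (p := 3 * (12 * m + 1) * (3 * m + 1))
      (q := (8 * m + 1) * (8 * m + 3)) (T := (t : ℝ) ^ 3) (by positivity)
      (by have : (0 : ℝ) ≤ m := m.cast_nonneg
          nlinarith) hs
    rw [cubicNum_four_mul_add_one, cubicDen_four_mul, cubicDen_four_mul_add_one]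
    push_cast
    rw [ha]
    convert h using 3
    ring
  · have h := abs_mul_pow_le_of_coeff_le (p := 3 * (12 * m + 5) * (3 * m + 2))
      (q := (8 * m + 3) * (8 * m + 5)) (T := (t : ℝ) ^ 3) (by positivity)
      (by have : (0 : ℝ) ≤ m := m.cast_nonneg
          nlinarith) hs
    rw [cubicNum_four_mul_add_two, cubicDen_four_mul_add_one, cubicDen_four_mul_add_two]
    push_cast
    rw [ha]
    convert h using 3
    ring
  · have h := abs_mul_pow_le_of_coeff_le (p := 3 * (12 * m + 7) * (6 * m + 5))
      (q := 2 * (8 * m + 5) * (8 * m + 7)) (T := (t : ℝ) ^ 3) (by positivity)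
      (by have : (0 : ℝ) ≤ m := m.cast_nonneg
          nlinarith) hs
    rw [cubicNum_four_mul_add_three, cubicDen_four_mul_add_two, cubicDen_four_mul_add_three]
    push_cast
    rw [ha]
    convert h using 3
    ring
  -- Here `i + 1 = 4 * (m + 1)`, so the formula for `num` is taken at `k = m + 1`.
  · have h := abs_mul_pow_le_of_coeff_le (p := 3 * (12 * m + 11) * (6 * m + 7))
      (q := 2 * (8 * m + 7) * (8 * m + 9)) (T := (t : ℝ) ^ 3) (by positivity)
      (by have : (0 : ℝ) ≤ m := m.cast_nonneg
          nlinarith) hs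
    rw [show 4 * m + 3 + 1 = 4 * (m + 1) by ring, cubicNum_four_mul,
      cubicDen_four_mul_add_three, cubicDen_four_mul]
    push_cast
    rw [ha]
    convert h using 2
    · ring
    · congr 1
      ring

/-- The values of the hypergeometric series of even index in the Gauss continued fraction. -/
def evenTail (z : ℝ) (n : ℕ) : ℝ :=
  seriesEval z (gaussSeries (n + 1 / 6) (n - 1 / 6) (2 * n + 1 / 2))

/-- The values of the hypergeometric series of odd index in the Gauss continued fraction. -/
def oddTail (z : ℝ) (n : ℕ) : ℝ :=
  seriesEval z (gaussSeries (n + 1 / 6) (n + 5 / 6) (2 * n + 3 / 2))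

/-- Gauss's contiguity relation, multiplied by 4 to clear the halves in `c * (c + 1)`. -/
lemma evenTail_sub_oddTail {z : ℝ} (hz : |z| ≤ 1 / 4) (n : ℕ) :
    (4 * n + 1) * (4 * n + 3) * (evenTail z n - oddTail z n) =
      -(4 * (n + 1 / 6) * (n + 2 / 3)) * z * evenTail z (n + 1) := by
  have hn : (0 : ℝ) ≤ n := n.cast_nonneg
  have h := seriesEval_contiguous (a := n + 1 / 6) (b := n - 1 / 6) (c := 2 * n + 1 / 2) (z := z)
    (m := n) (abs_le.2 ⟨by linarith, by linarith⟩) (abs_le.2 ⟨by linarith, by linarith⟩)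
    (abs_le.2 ⟨by linarith, by linarith⟩)
    (by push_cast; exact abs_le.2 ⟨by linarith, by linarith⟩)
    (abs_le.2 ⟨by linarith, by linarith⟩) (by positivity) hz
  unfold evenTail oddTail
  push_cast
  rw [show (n : ℝ) - 1 / 6 + 1 = n + 5 / 6 by ring,
    show 2 * (n : ℝ) + 1 / 2 + 1 = 2 * n + 3 / 2 by ring] at h
  rw [show (n : ℝ) + 1 + 1 / 6 = n + 1 / 6 + 1 by ring,
    show (n : ℝ) + 1 - 1 / 6 = n + 5 / 6 by ring,
    show 2 * ((n : ℝ) + 1) + 1 / 2 = 2 * n + 1 / 2 + 2 by ring]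
  linear_combination 4 * h

lemma oddTail_sub_evenTail {z : ℝ} (hz : |z| ≤ 1 / 4) (n : ℕ) :
    (4 * n + 3) * (4 * n + 5) * (oddTail z n - evenTail z (n + 1)) =
      -(4 * (n + 5 / 6) * (n + 4 / 3)) * z * oddTail z (n + 1) := by
  have hn : (0 : ℝ) ≤ n := n.cast_nonneg
  have h := seriesEval_contiguous (a := n + 5 / 6) (b := n + 1 / 6) (c := 2 * n + 3 / 2) (z := z)
    (m := n) (abs_le.2 ⟨by linarith, by linarith⟩) (abs_le.2 ⟨by linarith, by linarith⟩)
    (abs_le.2 ⟨by linarith, by linarith⟩)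
    (by push_cast; exact abs_le.2 ⟨by linarith, by linarith⟩)
    (abs_le.2 ⟨by linarith, by linarith⟩) (by positivity) hz
  unfold evenTail oddTail
  push_cast
  -- Contiguity raises only the second upper parameter; swapping the two lets successive steps raise
  -- them alternately.
  rw [seriesEval_gaussSeries_symm _ ((n : ℝ) + 1 / 6),
    seriesEval_gaussSeries_symm _ ((n : ℝ) + 1 / 6 + 1),
    seriesEval_gaussSeries_symm _ ((n : ℝ) + 1 / 6 + 1)] at h
  rw [show (n : ℝ) + 1 + 1 / 6 = n + 1 / 6 + 1 by ring,
    show (n : ℝ) + 1 - 1 / 6 = n + 5 / 6 by ring,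
    show (n : ℝ) + 1 + 5 / 6 = n + 5 / 6 + 1 by ring,
    show 2 * ((n : ℝ) + 1) + 1 / 2 = 2 * n + 3 / 2 + 1 by ring,
    show 2 * ((n : ℝ) + 1) + 3 / 2 = 2 * n + 3 / 2 + 2 by ring]
  linear_combination 4 * h

/-- The solution of the tail recurrence of the closed-form continued fraction. -/
def cubicTail (z : ℝ) (i : ℕ) : ℝ :=
  if i % 2 = 0 then evenTail z (i / 2) else oddTail z (i / 2)

lemma cubicTail_two_mul (z : ℝ) (n : ℕ) : cubicTail z (2 * n) = evenTail z n := by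
  rw [cubicTail, if_pos (by omega), show 2 * n / 2 = n by omega]

lemma cubicTail_two_mul_add_one (z : ℝ) (n : ℕ) : cubicTail z (2 * n + 1) = oddTail z n := by
  rw [cubicTail, if_neg (by omega), show (2 * n + 1) / 2 = n by omega]

lemma abs_cubicTail_le {z : ℝ} (hz : |z| ≤ 1 / 4) (i : ℕ) : |cubicTail z i| ≤ 2 * 2 ^ i := by
  have hn : (0 : ℝ) ≤ (i / 2 : ℕ) := Nat.cast_nonneg _
  have h : |cubicTail z i| ≤ 2 * 2 ^ (i / 2) := by
    unfold cubicTail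
    split_ifs
    · exact abs_seriesEval_gaussSeries_le (abs_le.2 ⟨by linarith, by linarith⟩)
        (abs_le.2 ⟨by linarith, by linarith⟩) (by positivity) hz
    · exact abs_seriesEval_gaussSeries_le (abs_le.2 ⟨by linarith, by linarith⟩)
        (abs_le.2 ⟨by linarith, by linarith⟩) (by positivity) hz
  refine h.trans ?_
  gcongr
  · norm_num
  · omega

/-- Consecutive denominators contribute `t * t ^ 2`, which turns `s` into `α`. The period four comes
from integrality: Gauss's coefficient `27 (n + 1/6)(n + 2/3)` equals `3/2 (6n + 1)(3n + 2)`, an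
integer for even `n` but half an odd integer for odd `n`. The coefficient `27 (n + 5/6)(n + 4/3)`
behaves alike. The factor 2 in `den (4 m + 3)` clears these halves. -/
lemma cubicTail_recurrence {a t : ℤ} {s : ℝ} (ha : (a : ℝ) = t ^ 3 * s)
    (hz : |-27 / 4 * s| ≤ 1 / 4) (i : ℕ) :
    (cubicDen t i : ℝ) * cubicDen t (i + 1) *
        (cubicTail (-27 / 4 * s) i - cubicTail (-27 / 4 * s) (i + 1)) =
      cubicNum a (i + 1) * cubicTail (-27 / 4 * s) (i + 2) := by
  obtain ⟨m, rfl | rfl | rfl | rfl⟩ := exists_eq_four_mul_add i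
  · have h := evenTail_sub_oddTail hz (2 * m)
    rw [show 4 * m = 2 * (2 * m) by ring, cubicTail_two_mul, cubicTail_two_mul_add_one,
      show 2 * (2 * m) + 2 = 2 * (2 * m + 1) by ring, cubicTail_two_mul,
      show 2 * (2 * m) = 4 * m by ring, cubicNum_four_mul_add_one, cubicDen_four_mul,
      cubicDen_four_mul_add_one]
    push_cast at h ⊢
    rw [ha]
    linear_combination (t : ℝ) ^ 3 * h
  · have h := oddTail_sub_evenTail hz (2 * m)
    rw [show 4 * m + 1 = 2 * (2 * m) + 1 by ring, cubicTail_two_mul_add_one,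
      show 2 * (2 * m) + 1 + 1 = 2 * (2 * m + 1) by ring, cubicTail_two_mul,
      show 2 * (2 * m) + 1 + 2 = 2 * (2 * m + 1) + 1 by ring, cubicTail_two_mul_add_one,
      show 2 * (2 * m) + 1 = 4 * m + 1 by ring, show 2 * (2 * m + 1) = 4 * m + 2 by ring,
      cubicNum_four_mul_add_two, cubicDen_four_mul_add_one, cubicDen_four_mul_add_two]
    push_cast at h ⊢
    rw [ha]
    linear_combination (t : ℝ) ^ 3 * h
  · have h := evenTail_sub_oddTail hz (2 * m + 1)
    rw [show 4 * m + 2 = 2 * (2 * m + 1) by ring, cubicTail_two_mul, cubicTail_two_mul_add_one,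
      show 2 * (2 * m + 1) + 2 = 2 * (2 * m + 1 + 1) by ring, cubicTail_two_mul,
      show 2 * (2 * m + 1) + 1 = 4 * m + 3 by ring, show 2 * (2 * m + 1) = 4 * m + 2 by ring,
      cubicNum_four_mul_add_three, cubicDen_four_mul_add_two, cubicDen_four_mul_add_three]
    push_cast at h ⊢
    rw [ha]
    linear_combination 2 * (t : ℝ) ^ 3 * h
  · have h := oddTail_sub_evenTail hz (2 * m + 1)
    rw [show 4 * m + 3 = 2 * (2 * m + 1) + 1 by ring, cubicTail_two_mul_add_one,
      show 2 * (2 * m + 1) + 1 + 1 = 2 * (2 * m + 1 + 1) by ring, cubicTail_two_mul,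
      show 2 * (2 * m + 1) + 1 + 2 = 2 * (2 * m + 1 + 1) + 1 by ring, cubicTail_two_mul_add_one,
      show 2 * (2 * m + 1) + 1 = 4 * m + 3 by ring, show 2 * (2 * m + 1 + 1) = 4 * (m + 1) by ring,
      cubicNum_four_mul, cubicDen_four_mul_add_three, cubicDen_four_mul]
    push_cast at h ⊢
    rw [ha]
    linear_combination 2 * (t : ℝ) ^ 3 * h

lemma evenTail_oddTail_cubic {z : ℝ} (hz : |z| ≤ 1 / 4) :
    27 * evenTail z 0 ^ 3 - 27 * evenTail z 0 ^ 2 * oddTail z 0 + 4 * z * oddTail z 0 ^ 3 = 0 := by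
  have e0 : evenTail z 0 = seriesEval z (gaussSeries (1 / 6) (-1 / 6) (1 / 2)) := by
    unfold evenTail
    norm_num
  have e1 : oddTail z 0 = seriesEval z (gaussSeries (1 / 6) (5 / 6) (3 / 2)) := by
    unfold oddTail
    norm_num
  have hu : AbsSummableAt z (gaussSeries (1 / 6) (-1 / 6) (1 / 2)) :=
    absSummableAt_gaussSeries (m := 0) (by norm_num [abs_le]) (by norm_num [abs_le])
      (by norm_num) hz
  have hv : AbsSummableAt z (gaussSeries (1 / 6) (5 / 6) (3 / 2)) :=
    absSummableAt_gaussSeries (m := 0) (by norm_num [abs_le]) (by norm_num [abs_le])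
      (by norm_num) hz
  have hc := gaussSeries_cubic
  rw [e0, e1]
  set u := gaussSeries (1 / 6) (-1 / 6) (1 / 2)
  set v := gaussSeries (1 / 6) (5 / 6) (3 / 2)
  -- The formal identity is written with sums and binary products only, so that evaluation can be
  -- pushed through it.
  have hc' : PowerSeries.C 27 * (u * (u * u)) + PowerSeries.C (-27) * (u * (u * v)) +
      PowerSeries.C 4 * (PowerSeries.X * (v * (v * v))) = 0 := by
    rw [map_neg, show PowerSeries.C (27 : ℝ) = 27 from map_ofNat _ 27,
      show PowerSeries.C (4 : ℝ) = 4 from map_ofNat _ 4]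
    linear_combination hc
  have h := congrArg (seriesEval z) hc'
  have hX := absSummableAt_X z
  have hC := absSummableAt_C z
  rw [seriesEval_add (((hC _).mul (hu.mul (hu.mul hu))).add ((hC _).mul (hu.mul (hu.mul hv))))
      ((hC _).mul (hX.mul (hv.mul (hv.mul hv)))),
    seriesEval_add ((hC _).mul (hu.mul (hu.mul hu))) ((hC _).mul (hu.mul (hu.mul hv))),
    seriesEval_mul (hC _) (hu.mul (hu.mul hu)), seriesEval_mul (hC _) (hu.mul (hu.mul hv)),
    seriesEval_mul (hC _) (hX.mul (hv.mul (hv.mul hv))), seriesEval_mul hu (hu.mul hu),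
    seriesEval_mul hu hu, seriesEval_mul hu (hu.mul hv), seriesEval_mul hu hv,
    seriesEval_mul hX (hv.mul (hv.mul hv)), seriesEval_mul hv (hv.mul hv), seriesEval_mul hv hv,
    seriesEval_X, seriesEval_C, seriesEval_C, seriesEval_C] at h
  rw [show seriesEval z 0 = 0 by simp [seriesEval]] at h
  linear_combination h

/-- A root of `y ^ 3 - t * y ^ 2 - a` close to `t` is the value of the continued fraction. -/
theorem cubicCF_convergesTo {a t : ℤ} {y : ℝ} (ht : t ≠ 0)
    (hy : y ^ 3 - t * y ^ 2 - a = 0) (hyt : |y / t - 1| ≤ 1 / 1000) :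
    CFConvergesTo (cubicCF a t) y := by
  have ht' : (t : ℝ) ≠ 0 := by exact_mod_cast ht
  obtain ⟨f, rfl⟩ : ∃ f, y = t * f := ⟨y / t, by field_simp⟩
  rw [mul_div_cancel_left₀ _ ht'] at hyt
  set s := f ^ 3 - f ^ 2 with hs_def
  have ha : (a : ℝ) = t ^ 3 * s := by
    rw [hs_def]
    linear_combination -hy
  have hf := abs_le.1 hyt
  have hs : |s| ≤ 1 / 500 := by
    have : s = f ^ 2 * (f - 1) := by ring
    rw [this, abs_mul, abs_of_nonneg (sq_nonneg f)]
    have h2 : f ^ 2 ≤ 2 := by nlinarith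
    calc f ^ 2 * |f - 1| ≤ 2 * (1 / 1000) := by gcongr
      _ = _ := by norm_num
  have hz : |-27 / 4 * s| ≤ 1 / 16 := by
    rw [abs_mul]
    norm_num [abs_of_neg, abs_div]
    linarith
  have hz4 : |-27 / 4 * s| ≤ 1 / 4 := hz.trans (by norm_num)
  have hcub := evenTail_oddTail_cubic hz4
  have hU : |evenTail (-27 / 4 * s) 0 - 1| ≤ 1 / 15 :=
    abs_seriesEval_gaussSeries_sub_one_le (by norm_num [abs_le]) (by norm_num [abs_le])
      (by norm_num) hz
  have hV : |oddTail (-27 / 4 * s) 0 - 1| ≤ 1 / 15 :=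
    abs_seriesEval_gaussSeries_sub_one_le (by norm_num [abs_le]) (by norm_num [abs_le])
      (by norm_num) hz
  have hconv := CFConvergesTo.of_tails (num := fun i => (cubicNum a i : ℝ))
    (den := fun i => (cubicDen t i : ℝ)) (g := cubicTail (-27 / 4 * s)) (C := 2)
    (fun i => by exact_mod_cast cubicDen_ne_zero ht i) (abs_cubicNum_le ha hs)
    (cubicTail_recurrence ha hz4)
    (by
      rw [show 1 = 2 * 0 + 1 from rfl, cubicTail_two_mul_add_one]
      have := abs_le.1 hV
      linarith)
    (abs_cubicTail_le hz4)
  rw [show cubicTail (-27 / 4 * s) 0 = evenTail (-27 / 4 * s) 0 from cubicTail_two_mul _ 0,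
    show cubicTail (-27 / 4 * s) 1 = oddTail (-27 / 4 * s) 0 from
      cubicTail_two_mul_add_one _ 0] at hconv
  set U := evenTail (-27 / 4 * s) 0
  set V := oddTail (-27 / 4 * s) 0
  have hU' := abs_le.1 hU
  have hV' := abs_le.1 hV
  have hV0 : 0 < V := by linarith
  have hden : (cubicDen t 0 : ℝ) = t := by simp [cubicDen]
  -- The bound is `(14/15) / (16/15)`.
  have hφ : 7 / 8 ≤ U / V := by
    rw [le_div_iff₀ hV0]
    linarith
  have hφs : (U / V) ^ 3 - (U / V) ^ 2 = s := by
    field_simp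
    linear_combination hcub / 27
  -- Both numbers solve `r ^ 3 - r ^ 2 = s` and are at least 7/8, where this function is injective:
  -- the cofactor in `hprod` is positive there.
  have hfφ : U / V = f := by
    have hprod : (U / V - f) * ((U / V) ^ 2 + U / V * f + f ^ 2 - U / V - f) = 0 := by
      linear_combination hφs
    rcases mul_eq_zero.1 hprod with h | h
    · linarith
    · have hf' : 7 / 8 ≤ f := by linarith
      nlinarith
  have : (cubicDen t 0 : ℝ) * U / V = t * f := by
    rw [hden, mul_div_assoc, hfφ]
  rw [this] at hconv
  exact hconv

end

/-! ### Reduction of a cubic irrationality -/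

/-- `1, w, w ^ 2` are linearly independent over `ℚ`. -/
def NotQuadratic (w : ℝ) : Prop :=
  ∀ r₀ r₁ r₂ : ℚ, (r₀ : ℝ) + r₁ * w + r₂ * w ^ 2 = 0 → r₀ = 0 ∧ r₁ = 0 ∧ r₂ = 0

lemma notQuadratic_of_natDegree {x : ℝ} (hx : (minpoly ℚ x).natDegree = 3) : NotQuadratic x := by
  intro r₀ r₁ r₂ h
  let p : Polynomial ℚ := Polynomial.C r₂ * Polynomial.X ^ 2 + Polynomial.C r₁ * Polynomial.X +
    Polynomial.C r₀
  have hp : Polynomial.aeval x p = 0 := by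
    simp only [p, map_add, map_mul, map_pow, Polynomial.aeval_C, Polynomial.aeval_X,
      eq_ratCast]
    linear_combination h
  have hp0 : p = 0 := by
    by_contra hne
    have h1 := Polynomial.natDegree_le_natDegree (minpoly.degree_le_of_ne_zero ℚ x hne hp)
    have h2 : p.natDegree ≤ 2 := Polynomial.natDegree_quadratic_le
    omega
  have c0 := congrArg (fun q => Polynomial.coeff q 0) hp0
  have c1 := congrArg (fun q => Polynomial.coeff q 1) hp0
  have c2 := congrArg (fun q => Polynomial.coeff q 2) hp0
  simp [p, Polynomial.coeff_X, Polynomial.coeff_C] at c0 c1 c2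
  exact ⟨c0, c1, c2⟩

lemma exists_cubic_of_natDegree {x : ℝ} (hx : (minpoly ℚ x).natDegree = 3) :
    ∃ e₀ e₁ e₂ : ℚ, x ^ 3 + e₂ * x ^ 2 + e₁ * x + e₀ = 0 := by
  have hint : IsIntegral ℚ x := by
    by_contra h
    rw [minpoly.eq_zero h] at hx
    simp at hx
  have hm := (minpoly.monic hint).coeff_natDegree
  rw [hx] at hm
  refine ⟨(minpoly ℚ x).coeff 0, (minpoly ℚ x).coeff 1, (minpoly ℚ x).coeff 2, ?_⟩
  have h := minpoly.aeval ℚ x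
  rw [Polynomial.aeval_eq_sum_range, hx] at h
  simp [Finset.sum_range_succ, hm, Algebra.smul_def] at h
  linear_combination h

lemma NotQuadratic.add_rat {x : ℝ} (h : NotQuadratic x) (e : ℚ) : NotQuadratic (x + e) := by
  intro r₀ r₁ r₂ h0
  obtain ⟨h1, h2, h3⟩ := h (r₀ + r₁ * e + r₂ * e ^ 2) (r₁ + 2 * r₂ * e) r₂ (by
    push_cast
    linear_combination h0)
  subst h3
  simp at h2
  subst h2
  simpa using h1

lemma NotQuadratic.ne_rat {w : ℝ} (h : NotQuadratic w) (r : ℚ) : w ≠ r := by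
  intro hw
  have := h (-r) 1 0 (by
    push_cast
    linear_combination hw)
  simp at this

/-- With zero discriminant and `P ≠ 0` the roots are the rationals `3Q/P` and, doubly, `-3Q/(2P)`;
with `P = 0` the only root is 0. -/
lemma NotQuadratic.disc_ne_zero {w : ℝ} (h : NotQuadratic w) {P Q : ℚ}
    (hw : w ^ 3 + P * w + Q = 0) : (4 * P ^ 3 + 27 * Q ^ 2 : ℝ) ≠ 0 := by
  intro hd
  by_cases hP : P = 0
  · have hQ : Q = 0 := by
      subst hP
      simpa using hd
    subst hP hQ
    have : w = 0 := by simpa using hw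
    exact h.ne_rat 0 (by simpa using this)
  · have hP' : (P : ℝ) ≠ 0 := by exact_mod_cast hP
    have hf : (w - 3 * Q / P) * (w + 3 * Q / (2 * P)) ^ 2 = 0 := by
      field_simp
      linear_combination 4 * (P : ℝ) ^ 3 * hw - (Q + w * P) * hd
    rcases mul_eq_zero.1 hf with h1 | h1
    · refine h.ne_rat (3 * Q / P) ?_
      push_cast
      linarith
    · refine h.ne_rat (-(3 * Q / (2 * P))) ?_
      push_cast
      linarith [pow_eq_zero_iff (two_ne_zero) |>.1 h1]

/-- A rational point where finitely many open conditions at a real point still hold. -/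
lemma exists_rat_of_eventually {ρ : ℝ} {p : ℝ → Prop} (h : ∀ᶠ A in 𝓝 ρ, p A) :
    ∃ A : ℚ, p A := by
  obtain ⟨U, hU, hUo, hρ⟩ := eventually_nhds_iff.1 h
  obtain ⟨A, hA⟩ := Rat.denseRange_cast (𝕜 := ℝ) |>.exists_mem_open hUo ⟨ρ, hρ⟩
  exact ⟨A, hU _ hA⟩

/-- At the real value `ρ` of `A` for which `3w² + Aw + 2P` vanishes, the quotient is zero and the
other two expressions are not. These conditions are open, so a nearby rational `A` satisfies them.
-/
lemma exists_good_parameter {w : ℝ} (h : NotQuadratic w) {P Q : ℚ}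
    (hw : w ^ 3 + P * w + Q = 0) {δ : ℝ} (hδ : 0 < δ) :
    ∃ A : ℚ, (P * A ^ 2 + 9 * A * Q - 3 * P ^ 2 : ℝ) ≠ 0 ∧ (A ^ 2 + 3 * P : ℝ) ≠ 0 ∧
      |(3 * w ^ 2 + A * w + 2 * P) ^ 2 / (P * A ^ 2 + 9 * A * Q - 3 * P ^ 2)| < δ := by
  have hw0 : w ≠ 0 := by simpa using h.ne_rat 0
  set ρ : ℝ := -(3 * w ^ 2 + 2 * P) / w with hρ
  have hρw : ρ * w = -(3 * w ^ 2 + 2 * P) := by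
    rw [hρ]
    field_simp
  -- Multiplied by `w ^ 2`, this expression becomes `4P³ + 27Q²`.
  have hp : (P * ρ ^ 2 + 9 * ρ * Q - 3 * P ^ 2 : ℝ) ≠ 0 := by
    intro h0
    apply h.disc_ne_zero hw
    have hQ : (Q : ℝ) = -w ^ 3 - P * w := by linear_combination hw
    rw [hQ] at h0 ⊢
    linear_combination w ^ 2 * h0 - (P * (ρ * w - (3 * w ^ 2 + 2 * P)) +
      9 * w * (-w ^ 3 - P * w)) * hρw
  have hg : (ρ ^ 2 + 3 * P : ℝ) ≠ 0 := by
    intro h0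
    have hf : (3 * w ^ 2 + 4 * P) * (3 * w ^ 2 + P) = 0 := by
      linear_combination w ^ 2 * h0 - (ρ * w - (3 * w ^ 2 + 2 * P)) * hρw
    rcases mul_eq_zero.1 hf with h1 | h1
    · have := h (4 * P) 0 3 (by
        push_cast
        linear_combination h1)
      simp at this
    · have := h P 0 3 (by
        push_cast
        linear_combination h1)
      simp at this
  have c1 : ContinuousAt (fun A : ℝ => P * A ^ 2 + 9 * A * Q - 3 * P ^ 2) ρ := by fun_prop
  have c2 : ContinuousAt (fun A : ℝ => A ^ 2 + 3 * P) ρ := by fun_prop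
  have c3 : ContinuousAt (fun A : ℝ =>
      |(3 * w ^ 2 + A * w + 2 * P) ^ 2 / (P * A ^ 2 + 9 * A * Q - 3 * P ^ 2)|) ρ :=
    (ContinuousAt.div (by fun_prop) c1 hp).abs
  have hz : 3 * w ^ 2 + ρ * w + 2 * P = 0 := by linear_combination hρw
  refine exists_rat_of_eventually (ρ := ρ) (p := fun A => (P * A ^ 2 + 9 * A * Q - 3 * P ^ 2) ≠ 0 ∧
    (A ^ 2 + 3 * P) ≠ 0 ∧
      |(3 * w ^ 2 + A * w + 2 * P) ^ 2 / (P * A ^ 2 + 9 * A * Q - 3 * P ^ 2)| < δ) ?_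
  filter_upwards [c1.eventually_ne hp, c2.eventually_ne hg,
    c3.eventually_lt (continuousAt_const (y := δ)) (by simpa [hz] using hδ)] with A h1 h2 h3
  exact ⟨h1, h2, h3⟩

/-- A Möbius transformation with rational coefficients bringing a cubic irrationality to a root
of a cubic `y ^ 3 - t * y ^ 2 - α` which is close to `t`. -/
lemma exists_rat_reduction {x : ℝ} (hx : (minpoly ℚ x).natDegree = 3) {δ : ℝ} (hδ : 0 < δ) :
    ∃ a b c d α t : ℚ, a * d - b * c ≠ 0 ∧ c ≠ 0 ∧ α ≠ 0 ∧ t ≠ 0 ∧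
      ((a * x + b) / (c * x + d)) ^ 3 - t * ((a * x + b) / (c * x + d)) ^ 2 - α = 0 ∧
      |(a * x + b) / (c * x + d) / t - 1| ≤ δ := by
  obtain ⟨e₀, e₁, e₂, he⟩ := exists_cubic_of_natDegree hx
  have hnq := (notQuadratic_of_natDegree hx).add_rat (e₂ / 3)
  set w : ℝ := x + (e₂ / 3 : ℚ) with hw_def
  obtain ⟨P, hP⟩ : ∃ P : ℚ, P = e₁ - e₂ ^ 2 / 3 := ⟨_, rfl⟩
  obtain ⟨Q, hQ⟩ : ∃ Q : ℚ, Q = e₀ - e₁ * e₂ / 3 + 2 * e₂ ^ 3 / 27 := ⟨_, rfl⟩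
  have hw : w ^ 3 + P * w + Q = 0 := by
    rw [hw_def, hP, hQ]
    push_cast
    linear_combination he
  obtain ⟨A, hp, hg, hsmall⟩ := exists_good_parameter hnq hw hδ
  set z := 3 * w ^ 2 + A * w + 2 * P with hz_def
  obtain ⟨p, hp_def⟩ : ∃ p : ℚ, p = P * A ^ 2 + 9 * A * Q - 3 * P ^ 2 := ⟨_, rfl⟩
  obtain ⟨q, hq_def⟩ : ∃ q : ℚ, q = -(2 * P ^ 3 + 27 * Q ^ 2 + 2 * A ^ 2 * P ^ 2 +
    9 * A * P * Q - A ^ 3 * Q) := ⟨_, rfl⟩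
  obtain ⟨g, hg_def⟩ : ∃ g : ℚ, g = -(A ^ 2 + 3 * P) := ⟨_, rfl⟩
  obtain ⟨k, hk_def⟩ : ∃ k : ℚ, k = -(9 * Q + 2 * A * P) := ⟨_, rfl⟩
  have hp' : (p : ℝ) = P * A ^ 2 + 9 * A * Q - 3 * P ^ 2 := by
    rw [hp_def]
    push_cast
    ring
  rw [← hp'] at hp hsmall
  have hg0 : g ≠ 0 := by
    rw [hg_def, neg_ne_zero]
    exact_mod_cast hg
  have hz0 : z ≠ 0 := by
    intro h0
    have := hnq (2 * P) A 3 (by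
      push_cast
      linear_combination h0)
    simp at this
  have hzq : z ^ 3 + p * z + q = 0 := by
    rw [hz_def, hp', hq_def]
    push_cast
    linear_combination (27 * w ^ 3 + 27 * A * w ^ 2 + (9 * A ^ 2 + 27 * P) * w +
      (A ^ 3 + 9 * A * P - 27 * Q)) * hw
  -- If `q = 0` then `z ^ 2 = -p`. Reduced modulo the cubic, this is a quadratic relation for `w`
  -- with leading coefficient `A ^ 2 + 3 * P ≠ 0`.
  have hq0 : q ≠ 0 := by
    intro h0
    rw [h0] at hzq
    have h1 : z ^ 2 + p = 0 := by
      apply mul_left_cancel₀ hz0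
      push_cast at hzq
      linear_combination hzq
    have := hnq (4 * P ^ 2 - 6 * A * Q + p) (4 * P * A - 9 * Q - 6 * A * P) (A ^ 2 + 3 * P) (by
      push_cast
      rw [hz_def] at h1
      linear_combination h1 - (9 * w + 6 * A) * hw)
    apply hg
    exact_mod_cast this.2.2
  have hp0 : p ≠ 0 := by exact_mod_cast hp
  have hq' : (q : ℝ) ≠ 0 := by exact_mod_cast hq0
  have hnum0 : 3 * w - A ≠ 0 := by
    intro h0
    refine hnq.ne_rat (A / 3) ?_
    push_cast
    linarith
  -- The factor `3 * w - A` is chosen to cancel the `w ^ 2` term, which exhibits `1 / z` as a Möbius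
  -- image of `w`.
  have hmul : z * (3 * w - A) = g * w + k := by
    rw [hz_def, hg_def, hk_def]
    push_cast
    linear_combination 9 * hw
  have hy : (3 * w - A) / (g * w + k) = 1 / z := by
    rw [← hmul]
    field_simp
  have hx1 : ((3 : ℚ) : ℝ) * x + ((e₂ - A : ℚ) : ℝ) = 3 * w - A := by
    rw [hw_def]
    push_cast
    ring
  have hx2 : (g : ℝ) * x + ((g * (e₂ / 3) + k : ℚ) : ℝ) = g * w + k := by
    rw [hw_def]
    push_cast
    ring
  refine ⟨3, e₂ - A, g, g * (e₂ / 3) + k, -1 / q, -p / q, ?_, hg0, ?_, ?_, ?_, ?_⟩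
  · intro h0
    -- The determinant is `-27` times the cubic at `A / 3`, so its vanishing would give a rational
    -- root and a quadratic relation for `w`.
    have h1 : A ^ 3 + 9 * P * A + 27 * Q = 0 := by
      rw [hg_def, hk_def] at h0
      linear_combination -h0
    have h1' : (A : ℝ) ^ 3 + 9 * P * A + 27 * Q = 0 := by exact_mod_cast h1
    have hf : (3 * w - A) * (9 * w ^ 2 + 3 * A * w + A ^ 2 + 9 * P) = 0 := by
      linear_combination 27 * hw - h1'
    have := hnq (A ^ 2 + 9 * P) (3 * A) 9 (by
      push_cast
      linear_combination (mul_eq_zero.1 hf).resolve_left hnum0)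
    simp at this
  · exact div_ne_zero (by norm_num) hq0
  · exact div_ne_zero (neg_ne_zero.2 hp0) hq0
  · rw [hx1, hx2, hy]
    push_cast
    field_simp
    linear_combination hzq
  · rw [hx1, hx2, hy]
    have e : 1 / z / ((-p / q : ℚ) : ℝ) - 1 = z ^ 2 / p := by
      push_cast
      field_simp
      linear_combination -hzq
    rw [e]
    exact hsmall.le

lemma exists_int_mul_eq (r : ℚ) {M : ℕ} (h : r.den ∣ M) : ∃ n : ℤ, (n : ℚ) = M * r := by
  obtain ⟨k, rfl⟩ := h
  refine ⟨k * r.num, ?_⟩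
  have := Rat.mul_den_eq_num r
  push_cast
  linear_combination (k : ℚ) * (-this)

/-- The integral form of `exists_rat_reduction`. -/
lemma exists_int_reduction {x : ℝ} (hx : (minpoly ℚ x).natDegree = 3) {δ : ℝ} (hδ : 0 < δ) :
    ∃ a b c d α t : ℤ, a * d - b * c ≠ 0 ∧ c ≠ 0 ∧ α ≠ 0 ∧ t ≠ 0 ∧
      ((a * x + b) / (c * x + d)) ^ 3 - t * ((a * x + b) / (c * x + d)) ^ 2 - α = 0 ∧
      |(a * x + b) / (c * x + d) / t - 1| ≤ δ := by
  obtain ⟨a, b, c, d, α, t, hdet, hc, hα, ht, hy, hyt⟩ := exists_rat_reduction hx hδ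
  obtain ⟨M, hM⟩ : ∃ M : ℕ, M = a.den * b.den * c.den * d.den := ⟨_, rfl⟩
  obtain ⟨N, hN⟩ : ∃ N : ℕ, N = α.den * t.den := ⟨_, rfl⟩
  have hM0 : (M : ℚ) ≠ 0 := by
    rw [hM]
    exact_mod_cast (by positivity : a.den * b.den * c.den * d.den ≠ 0)
  have hN0 : (N : ℚ) ≠ 0 := by
    rw [hN]
    exact_mod_cast (by positivity : α.den * t.den ≠ 0)
  -- Replacing `y` by `N * y` changes `t` to `N * t` and `α` to `N ^ 3 * α` and preserves `y / t`;
  -- hence the extra `N` in the numerator row. The factor `M` is common to both rows and leaves the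
  -- map unchanged.
  obtain ⟨a', ha⟩ := exists_int_mul_eq a (M := N * M) (hM ▸ ⟨N * (b.den * c.den * d.den), by ring⟩)
  obtain ⟨b', hb⟩ := exists_int_mul_eq b (M := N * M) (hM ▸ ⟨N * (a.den * c.den * d.den), by ring⟩)
  obtain ⟨c', hc'⟩ := exists_int_mul_eq c (M := M) (hM ▸ ⟨a.den * b.den * d.den, by ring⟩)
  obtain ⟨d', hd⟩ := exists_int_mul_eq d (M := M) (hM ▸ ⟨a.den * b.den * c.den, by ring⟩)
  obtain ⟨α', hα'⟩ := exists_int_mul_eq α (M := N ^ 3)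
    (hN ▸ ⟨t.den * (α.den * t.den) ^ 2, by ring⟩)
  obtain ⟨t', ht'⟩ := exists_int_mul_eq t (M := N) (hN ▸ ⟨α.den, by ring⟩)
  push_cast at ha hb hα'
  have hMR : (M : ℝ) ≠ 0 := by exact_mod_cast hM0
  have hNR : (N : ℝ) ≠ 0 := by exact_mod_cast hN0
  have haR : (a' : ℝ) = N * M * a := by exact_mod_cast congrArg (Rat.cast : ℚ → ℝ) ha
  have hbR : (b' : ℝ) = N * M * b := by exact_mod_cast congrArg (Rat.cast : ℚ → ℝ) hb
  have hcR : (c' : ℝ) = M * c := by exact_mod_cast congrArg (Rat.cast : ℚ → ℝ) hc'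
  have hdR : (d' : ℝ) = M * d := by exact_mod_cast congrArg (Rat.cast : ℚ → ℝ) hd
  have hαR : (α' : ℝ) = N ^ 3 * α := by exact_mod_cast congrArg (Rat.cast : ℚ → ℝ) hα'
  have htR : (t' : ℝ) = N * t := by exact_mod_cast congrArg (Rat.cast : ℚ → ℝ) ht'
  have hyR : (a' * x + b') / (c' * x + d') = N * ((a * x + b) / (c * x + d)) := by
    rw [haR, hbR, hcR, hdR, show N * M * a * x + N * M * b = M * (N * (a * x + b)) by ring,
      show M * c * x + M * d = M * (c * x + d) by ring, mul_div_mul_left _ _ hMR, mul_div_assoc]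
  refine ⟨a', b', c', d', α', t', ?_, ?_, ?_, ?_, ?_, ?_⟩
  · have : ((a' * d' - b' * c' : ℤ) : ℚ) = N * M ^ 2 * (a * d - b * c) := by
      push_cast
      rw [ha, hb, hc', hd]
      ring
    intro h0
    rw [h0] at this
    exact mul_ne_zero (mul_ne_zero hN0 (pow_ne_zero 2 hM0)) hdet (by simpa using this.symm)
  · have : (c' : ℚ) ≠ 0 := hc' ▸ mul_ne_zero hM0 hc
    exact_mod_cast this
  · have : (α' : ℚ) ≠ 0 := hα' ▸ mul_ne_zero (pow_ne_zero 3 hN0) hα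
    exact_mod_cast this
  · have : (t' : ℚ) ≠ 0 := ht' ▸ mul_ne_zero hN0 ht
    exact_mod_cast this
  · rw [hyR, hαR, htR]
    linear_combination (N : ℝ) ^ 3 * hy
  · rw [hyR, htR, mul_div_mul_left _ _ hNR]
    exact hyt

theorem theorem3 (x : ℝ) (hx : (minpoly ℚ x).natDegree = 3) :
    ∃ a b c d : ℤ, a * d - b * c ≠ 0 ∧ c ≠ 0 ∧
      ∃ α t : ℤ, α ≠ 0 ∧ t ≠ 0 ∧
        (((a * x + b) / (c * x + d)) ^ 3 - t * ((a * x + b) / (c * x + d)) ^ 2 - α = 0) ∧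
        CFConvergesTo (cubicCF α t) ((a * x + b) / (c * x + d)) ∧
        CFConvergesTo (mobiusCubicCF d (-b) (-c) a α t) x := by
  obtain ⟨a, b, c, d, α, t, hdet, hc, hα, ht, hy, hyt⟩ :=
    exists_int_reduction hx (by norm_num : (0 : ℝ) < 1 / 1000)
  have hconv := cubicCF_convergesTo ht hy hyt
  refine ⟨a, b, c, d, hdet, hc, α, t, hα, ht, hy, hconv, ?_⟩
  have hden : (c : ℝ) * x + d ≠ 0 := by
    intro h0
    have := notQuadratic_of_natDegree hx d c 0 (by
      push_cast
      linear_combination h0)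
    exact hc (by exact_mod_cast this.2.1)
  have hdetR : (a * d - b * c : ℝ) ≠ 0 := by exact_mod_cast hdet
  -- The matrix `(d, -b; -c, a)` is the adjugate of `(a, b; c, d)`, so it returns `y` to `x`, the
  -- determinant cancelling between `e1` and `e2`.
  have e1 : ((-c : ℤ) : ℝ) * ((a * x + b) / (c * x + d)) + a = (a * d - b * c) / (c * x + d) := by
    push_cast
    field_simp
    ring
  have e2 : (d : ℝ) * ((a * x + b) / (c * x + d)) + ((-b : ℤ) : ℝ) =
      (a * d - b * c) * x / (c * x + d) := by
    push_cast
    rw [eq_div_iff hden, add_mul, mul_assoc, div_mul_cancel₀ _ hden]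
    ring
  have h := hconv.mobius (u := d) (v := -b) (w := -c) (z := a) (neg_ne_zero.2 hc)
    (by
      rw [e1]
      exact div_ne_zero hdetR hden)
  rw [e1, e2, div_div_div_cancel_right₀ hden, mul_div_cancel_left₀ _ hdetR] at h
  exact h
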